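/- Let $n\in\mathbb N$ and $2\le p<\infty$, let $p'=p/(p-1)$ be the dual exponent, and let $S(t)=e^{it\Delta}$ be the Schrödinger group on $\mathbb R^n$, i.e. the Fourier multiplier operator on tempered distributions with symbol $e^{-4\pi^2 it|\xi|^2}$ (for the normalization $\widehat f(\xi)=\int e^{-2\pi i x\cdot\xi}f(x)\,dx$). For $0<r,q<\infty$ and measurable $f:\mathbb R^n\to\mathbb C$ let $$\|f\|_{L^{r,q}}=\Big(\int_0^\infty \big(s^{1/r}f^*(s)\big)^q\,\frac{ds}{s}\Big)^{1/q},\qquad f^*(s)=\inf\{a\ge 0:\ |\{x:|f(x)|>a\}|\le s\},$$ and let $L^{r,q}=L^{r,q}(\mathbb R^n)$ be the Lorentz space of those $f$ with $\|f\|_{L^{r,q}}<\infty$. Then there is a constant $C$ depending only on $n$ and $p$ such that every $f\in L^{p',2}(\mathbb R^n)$ is a tempered distribution, and for every $t\in\mathbb R$ the tempered distribution $S(t)f$ is given by a function, which satisfies $$\|S(t)f\|_{L^{p,2}}\le C\,|t|^{-n\left(\frac12-\frac1p\right)}\,\|f\|_{L^{p',2}}.$$ In particular $S(t)f\in L^{p,2}(\mathbb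 R^n)$ for $t\ne0$. (A function "is" the tempered distribution $\varphi\mapsto\int\varphi f\,dx$, where $\varphi f$ is integrable for every Schwartz function $\varphi$. For $t=0$ the right-hand side is read in $[0,\infty]$ with $0^{0}=1$, $0^{-a}=\infty$ for $a>0$, and $\infty\cdot 0=0$.) -/

import Mathlib

open MeasureTheory
open scoped ENNReal NNReal SchwartzMap

noncomputable section

/-- The decreasing rearrangement `f*(s) = inf {a ≥ 0 : μ {x : |f x| > a} ≤ s}` of a complex-valued
function, with values in `[0, ∞]` (and `inf ∅ = ∞`). -/
def decreasingRearrangement {α : Type*} [MeasurableSpace α] (μ : Measure α) (f : α → ℂ) (s : ℝ) :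
    ℝ≥0∞ :=
  sInf {a : ℝ≥0∞ | μ {x | a < ‖f x‖ₑ} ≤ ENNReal.ofReal s}

/-- The Lorentz quasi-norm
`‖f‖_{L^{p,q}} = (∫₀^∞ (s^{1/p} f*(s))^q ds/s)^{1/q}` for `0 < p, q < ∞`, with values in `[0, ∞]`. -/
def eLorentzNorm {α : Type*} [MeasurableSpace α] (f : α → ℂ) (p q : ℝ) (μ : Measure α) : ℝ≥0∞ :=
  (∫⁻ s in Set.Ioi (0 : ℝ),
    (ENNReal.ofReal s ^ (1 / p) * decreasingRearrangement μ f s) ^ q / ENNReal.ofReal s) ^ (1 / q)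

/-- `f` belongs to the Lorentz space `L^{p,q}(μ)`, `0 < p, q < ∞`. -/
def MemLorentz {α : Type*} [MeasurableSpace α] (f : α → ℂ) (p q : ℝ) (μ : Measure α) : Prop :=
  AEStronglyMeasurable f μ ∧ eLorentzNorm f p q μ < ∞

/-- The tempered distribution `u` on `ℝⁿ` is given by the function `f`: every product of `f` with
a Schwartz function `φ` is integrable, and `u(φ) = ∫ φ f`. -/
def IsGivenBy {n : ℕ} (u : 𝓢'(EuclideanSpace ℝ (Fin n), ℂ)) (f : EuclideanSpace ℝ (Fin n) → ℂ) :
    Prop :=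
  AEStronglyMeasurable f volume ∧
    ∀ φ : 𝓢(EuclideanSpace ℝ (Fin n), ℂ),
      Integrable (fun x ↦ φ x * f x) volume ∧ u φ = ∫ x, φ x * f x

/-- The symbol `exp(-4π² i t |ξ|²)` of `e^{itΔ}`, for the Fourier transform
`𝓕 f(ξ) = ∫ exp(-2πi⟨x, ξ⟩) f(x) dx`, under which `Δ` has the symbol `-4π²|ξ|²`. -/
def schrodingerSymbol (n : ℕ) (t : ℝ) (ξ : EuclideanSpace ℝ (Fin n)) : ℂ :=
  Complex.exp (((-(4 * Real.pi ^ 2 * t * ‖ξ‖ ^ 2) : ℝ) : ℂ) * Complex.I)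

/-- The symbol is smooth and all its derivatives grow at most polynomially, so multiplication by it
is a genuine operation on tempered distributions (`fourierMultiplierCLM` is not a default value). -/
theorem schrodingerSymbol_hasTemperateGrowth (n : ℕ) (t : ℝ) :
    (schrodingerSymbol n t).HasTemperateGrowth := by
  have key : Function.HasTemperateGrowth (fun s : ℝ ↦ Complex.exp ((s : ℂ) * Complex.I)) := by
    have hd : ∀ k : ℕ, iteratedDeriv k (fun s : ℝ ↦ Complex.exp ((s : ℂ) * Complex.I)) =
        fun s : ℝ ↦ Complex.I ^ k * Complex.exp ((s : ℂ) * Complex.I) := by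
      intro k
      induction k with
      | zero => simp
      | succ k ih =>
        rw [iteratedDeriv_succ, ih]
        funext s
        have h1 : HasDerivAt (fun s : ℝ ↦ (s : ℂ) * Complex.I) (1 * Complex.I) s :=
          (Complex.ofRealCLM.hasDerivAt (x := s)).mul_const Complex.I
        have h2 := (h1.cexp).const_mul (Complex.I ^ k)
        rw [h2.deriv]
        ring
    refine ⟨(Complex.ofRealCLM.contDiff.mul contDiff_const).cexp, fun k ↦ ⟨0, 1, fun s ↦ ?_⟩⟩
    rw [norm_iteratedFDeriv_eq_norm_iteratedDeriv, hd]
    simp [Complex.norm_exp_ofReal_mul_I]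
  have hq : Function.HasTemperateGrowth
      (fun ξ : EuclideanSpace ℝ (Fin n) ↦ -(4 * Real.pi ^ 2 * t * ‖ξ‖ ^ 2)) := by
    fun_prop
  exact key.comp hq

/-- The Schrödinger group `S(t) = e^{itΔ}` on tempered distributions on `ℝⁿ`: the Fourier
multiplier with symbol `exp(-4π² i t |ξ|²)`. -/
def schrodingerGroup (n : ℕ) (t : ℝ) :
    𝓢'(EuclideanSpace ℝ (Fin n), ℂ) →L[ℂ] 𝓢'(EuclideanSpace ℝ (Fin n), ℂ) :=
  TemperedDistribution.fourierMultiplierCLM ℂ (schrodingerSymbol n t)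

end

/-!
The proof is real interpolation between the two basic bounds for `e^{itΔ}`, `t ≠ 0`: it does not
increase the `L²` norm (Plancherel, `exists_schrodingerGroup_isGivenBy_of_memLp_two`), and it maps
`L¹` to `L^∞` with norm `A = (4π|t|)^{-n/2}`, being convolution with an explicit bounded kernel
(`exists_schrodingerGroup_isGivenBy_of_integrable`). The kernel is found by transposing the
multiplier onto a Schwartz function and letting `ε → 0⁺` in the Gaussians `exp(-4π²(ε+it)|ξ|²)`.

For `p > 2`, put `K = A⁻²`. To estimate `g = e^{itΔ} f` at `s > 0`, truncate `f` at the height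
`f*(K/s)`, sending the large part through the `L¹` bound and the small part through the `L²` bound.
As `f` and `f*` are equimeasurable (`lintegral_enorm_rpow_eq_lintegral_decreasingRearrangement`),
this gives
`g*(s)² ≤ 4 K⁻¹ (∫_{u < K/s} f*(u) du)² + 2 s⁻¹ ∫_{u ≥ K/s} f*(u)² du`
(`decreasingRearrangement_sq_le_of_splitting`). Integrating against `s^{2/p-1} ds`, the two terms
are bounded by the Hardy inequalities `lintegral_rpow_mul_sq_lintegral_Ioo_div_le` and
`lintegral_rpow_mul_lintegral_Ici_div`, which use `p < ∞` and `p > 2` respectively; the powers of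
`K` combine to `K^{2/p-1}`. The truncation depends on `s`, but all the resulting functions
represent the same tempered distribution, hence agree almost everywhere (`IsGivenBy.ae_eq`).

For `p = 2` the Lorentz space is `L²` with equal norms, and the `L²` bound alone suffices.
-/

open FourierTransform

/-! ### Functions as tempered distributions and the `L²` bound -/

section TemperedDistribution

variable {n : ℕ}

local notation "𝔼" => EuclideanSpace ℝ (Fin n)

theorem IsGivenBy.add {u v : 𝓢'(𝔼, ℂ)} {f g : 𝔼 → ℂ} (hu : IsGivenBy u f) (hv : IsGivenBy v g) :
    IsGivenBy (u + v) (f + g) := by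
  refine ⟨hu.1.add hv.1, fun φ ↦ ?_⟩
  have h1 := hu.2 φ
  have h2 := hv.2 φ
  have e : (fun x ↦ φ x * (f + g) x) = fun x ↦ φ x * f x + φ x * g x := by
    ext x; simp [mul_add]
  rw [e]
  refine ⟨h1.1.add h2.1, ?_⟩
  rw [integral_add h1.1 h2.1, ← h1.2, ← h2.2]
  rfl

theorem IsGivenBy.congr_ae {u : 𝓢'(𝔼, ℂ)} {f g : 𝔼 → ℂ} (hu : IsGivenBy u f)
    (h : f =ᵐ[volume] g) : IsGivenBy u g := by
  refine ⟨hu.1.congr h, fun φ ↦ ?_⟩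
  have e : (fun x ↦ φ x * f x) =ᵐ[volume] fun x ↦ φ x * g x := by
    filter_upwards [h] with x hx
    rw [hx]
  exact ⟨(hu.2 φ).1.congr e, by rw [(hu.2 φ).2, integral_congr_ae e]⟩

theorem IsGivenBy.locallyIntegrable {u : 𝓢'(𝔼, ℂ)} {f : 𝔼 → ℂ} (hu : IsGivenBy u f) :
    LocallyIntegrable f volume := by
  intro x
  let b : ContDiffBump x := ⟨1, 2, one_pos, one_lt_two⟩
  have hc : HasCompactSupport (Complex.ofRealCLM ∘ b) := b.hasCompactSupport.comp_left rfl
  have hs : ContDiff ℝ (⊤ : ℕ∞) (Complex.ofRealCLM ∘ b) := Complex.ofRealCLM.contDiff.comp b.contDiff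
  refine ⟨Metric.closedBall x 1, Metric.closedBall_mem_nhds x one_pos, ?_⟩
  have h := ((hu.2 (hc.toSchwartzMap hs)).1).integrableOn (s := Metric.closedBall x 1)
  refine h.congr_fun (fun y hy ↦ ?_) measurableSet_closedBall
  have : b y = 1 := b.one_of_mem_closedBall hy
  simp [this]

/-- A tempered distribution is given by at most one function, up to null sets. -/
theorem IsGivenBy.ae_eq {u : 𝓢'(𝔼, ℂ)} {f g : 𝔼 → ℂ} (hf : IsGivenBy u f) (hg : IsGivenBy u g) :
    f =ᵐ[volume] g := by
  refine ae_eq_of_integral_contDiff_smul_eq hf.locallyIntegrable hg.locallyIntegrable ?_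
  intro φ φ_smooth φ_cpt
  have hc : HasCompactSupport (Complex.ofRealCLM ∘ φ) := φ_cpt.comp_left rfl
  have hs : ContDiff ℝ (⊤ : ℕ∞) (Complex.ofRealCLM ∘ φ) := by fun_prop
  have h1 := (hf.2 (hc.toSchwartzMap hs)).2
  have h2 := (hg.2 (hc.toSchwartzMap hs)).2
  simpa using h1.symm.trans h2

theorem isGivenBy_toTemperedDistribution {q : ℝ≥0∞} [hq : Fact (1 ≤ q)]
    (f : Lp ℂ q (volume : Measure 𝔼)) :
    IsGivenBy (Lp.toTemperedDistribution f) f := by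
  refine ⟨Lp.aestronglyMeasurable f, fun φ ↦ ⟨?_, by simp⟩⟩
  have := ENNReal.HolderConjugate.inv_one_sub_inv' hq.out
  exact (Lp.memLp f).integrable_mul (φ.memLp (1 - q⁻¹)⁻¹ volume) |>.congr
    (Filter.Eventually.of_forall fun x ↦ mul_comm _ _)

theorem exists_isGivenBy_of_memLp {q : ℝ≥0∞} (hq : 1 ≤ q) {f : 𝔼 → ℂ} (hf : MemLp f q volume) :
    ∃ u : 𝓢'(𝔼, ℂ), IsGivenBy u f :=
  haveI : Fact (1 ≤ q) := ⟨hq⟩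
  ⟨_, (isGivenBy_toTemperedDistribution (hf.toLp f)).congr_ae hf.coeFn_toLp⟩

theorem IsGivenBy.eq {u v : 𝓢'(𝔼, ℂ)} {f : 𝔼 → ℂ} (hu : IsGivenBy u f) (hv : IsGivenBy v f) :
    u = v := by
  ext φ
  rw [(hu.2 φ).2, (hv.2 φ).2]

theorem norm_schrodingerSymbol (t : ℝ) (ξ : 𝔼) : ‖schrodingerSymbol n t ξ‖ = 1 := by
  rw [schrodingerSymbol, Complex.norm_exp_ofReal_mul_I]

/-- The Schrödinger group does not increase the `L²` norm, by Plancherel's theorem. -/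
theorem exists_schrodingerGroup_isGivenBy_of_memLp_two (t : ℝ) {u : 𝓢'(𝔼, ℂ)} {f : 𝔼 → ℂ}
    (hu : IsGivenBy u f) (hf : MemLp f 2 volume) :
    ∃ g : 𝔼 → ℂ, IsGivenBy (schrodingerGroup n t u) g ∧
      eLpNorm g 2 volume ≤ eLpNorm f 2 volume := by
  have hm := schrodingerSymbol_hasTemperateGrowth n t
  have hm' : MemLp (schrodingerSymbol n t) ∞ volume :=
    memLp_top_of_bound hm.1.continuous.aestronglyMeasurable 1
      (Filter.Eventually.of_forall fun ξ ↦ (norm_schrodingerSymbol t ξ).le)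
  have hu' : u = Lp.toTemperedDistribution (hf.toLp f) :=
    hu.eq ((isGivenBy_toTemperedDistribution (hf.toLp f)).congr_ae hf.coeFn_toLp)
  let F : Lp ℂ 2 (volume : Measure 𝔼) := 𝓕 (hf.toLp f)
  let G : Lp ℂ 2 (volume : Measure 𝔼) := (hm'.toLp _) • F
  have e1 : Lp.toTemperedDistribution G = TemperedDistribution.smulLeftCLM ℂ
      (schrodingerSymbol n t) (Lp.toTemperedDistribution F) :=
    Lp.toTemperedDistribution_smul_eq hm hm' F
  have key : schrodingerGroup n t u = Lp.toTemperedDistribution (𝓕⁻ G) := by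
    rw [schrodingerGroup, TemperedDistribution.fourierMultiplierCLM_apply, hu',
      Lp.fourier_toTemperedDistribution_eq, ← e1,
      Lp.fourierInv_toTemperedDistribution_eq]
  refine ⟨(𝓕⁻ G : Lp ℂ 2 (volume : Measure 𝔼)), key ▸ isGivenBy_toTemperedDistribution _, ?_⟩
  have h1 : ‖(𝓕⁻ G : Lp ℂ 2 (volume : Measure 𝔼))‖ₑ = ‖G‖ₑ := by
    rw [← ofReal_norm, ← Lp.norm_fourier_eq, fourier_fourierInv_eq, ofReal_norm]
  have h2 : ‖F‖ₑ = ‖hf.toLp f‖ₑ := by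
    rw [← ofReal_norm, Lp.norm_fourier_eq, ofReal_norm]
  have h3 : ‖G‖ₑ ≤ ‖F‖ₑ := by
    rw [Lp.enorm_def, Lp.enorm_def]
    refine eLpNorm_mono_ae ?_
    filter_upwards [Lp.coeFn_lpSMul (r := 2) (hm'.toLp _) F, hm'.coeFn_toLp] with x hx hx'
    simp only [G]
    rw [hx, Pi.smul_apply', hx', norm_smul, norm_schrodingerSymbol, one_mul]
  rw [← Lp.enorm_def, h1]
  refine h3.trans ?_
  rw [h2, Lp.enorm_def, eLpNorm_congr_ae hf.coeFn_toLp]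

end TemperedDistribution

/-! ### The Schrödinger kernel and the dispersive estimate -/

section DispersiveEstimate

variable {n : ℕ}

local notation "𝔼" => EuclideanSpace ℝ (Fin n)

/-- The convolution kernel `(4πit)^{-n/2} exp(i|z|²/(4t))` of `e^{itΔ}`, `t ≠ 0`, written as the
Fourier transform of the complex Gaussian `exp(-b|ξ|²)` at the boundary value `b = 4π²it`. -/
noncomputable def schrodingerKernel (n : ℕ) (t : ℝ) (z : EuclideanSpace ℝ (Fin n)) : ℂ :=
  (Real.pi / (4 * Real.pi ^ 2 * t * Complex.I)) ^ (n / 2 : ℂ) *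
    Complex.exp (-Real.pi ^ 2 * ‖z‖ ^ 2 / (4 * Real.pi ^ 2 * t * Complex.I))

theorem continuous_schrodingerKernel (t : ℝ) : Continuous (schrodingerKernel n t) := by
  unfold schrodingerKernel
  fun_prop

theorem norm_schrodingerKernel (t : ℝ) (z : 𝔼) :
    ‖schrodingerKernel n t z‖ = ((4 * Real.pi * |t|)⁻¹) ^ (n / 2 : ℝ) := by
  have h1 : ((n : ℂ) / 2) = ((n / 2 : ℝ) : ℂ) := by push_cast; rfl
  have h2 : (-Real.pi ^ 2 * ‖z‖ ^ 2 / (4 * Real.pi ^ 2 * t * Complex.I) : ℂ) =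
      ((Real.pi ^ 2 * ‖z‖ ^ 2 / (4 * Real.pi ^ 2 * t) : ℝ) : ℂ) * Complex.I := by
    push_cast
    rw [div_mul_eq_div_div, Complex.div_I]
    ring
  rw [schrodingerKernel, norm_mul, h1, Complex.norm_cpow_real, h2, Complex.norm_exp_ofReal_mul_I,
    mul_one]
  congr 1
  have := Real.pi_pos
  simp only [norm_div, norm_mul, Complex.norm_real, Complex.norm_I, Real.norm_eq_abs, norm_pow,
    abs_of_pos this, Complex.norm_ofNat, mul_one]
  rcases eq_or_ne t 0 with rfl | ht
  · simp
  · have : |t| ≠ 0 := by simpa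
    field_simp

/-- On Schwartz functions, the transpose of `e^{itΔ}` is convolution with the kernel. The multiplier
`exp(-4π²it|ξ|²)` is the limit of the integrable Gaussians `exp(-4π²(ε+it)|ξ|²)` as `ε → 0⁺`. -/
theorem fourier_schrodingerSymbol_smul_fourierInv {t : ℝ} (ht : t ≠ 0) (φ : 𝓢(𝔼, ℂ)) (y : 𝔼) :
    𝓕 (SchwartzMap.smulLeftCLM ℂ (schrodingerSymbol n t) (𝓕⁻ φ)) y =
      ∫ x, schrodingerKernel n t (x - y) * φ x := by
  let b : ℝ → ℂ := fun ε ↦ 4 * Real.pi ^ 2 * (ε + t * Complex.I)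
  have hb : Continuous b := by fun_prop
  have hb0 : b 0 ≠ 0 := by simp [b, ht, Real.pi_ne_zero]
  have hb0' : b 0 = 4 * Real.pi ^ 2 * t * Complex.I := by simp [b, mul_assoc]
  have hre : ∀ ε, (b ε).re = 4 * Real.pi ^ 2 * ε := by
    intro ε
    have : b ε = ((4 * Real.pi ^ 2 * ε : ℝ) : ℂ) + ((4 * Real.pi ^ 2 * t : ℝ) : ℂ) * Complex.I := by
      simp [b]; ring
    rw [this, Complex.add_re, Complex.ofReal_re, Complex.re_ofReal_mul, Complex.I_re]
    ring
  have hre0 : ∀ ε, 0 < ε → 0 < (b ε).re := by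
    intro ε hε
    rw [hre]
    positivity
  -- The Gaussian with the modulation `exp(-2πi⟨y, ξ⟩)` of the outer Fourier transform.
  let G : ℝ → 𝔼 → ℂ := fun ε ξ ↦
    Complex.exp (-b ε * ‖ξ‖ ^ 2 + 2 * Real.pi * Complex.I * (inner ℝ (-y) ξ : ℝ))
  have hG : ∀ ε, 0 < ε → Integrable (G ε) := fun ε hε ↦
    GaussianFourier.integrable_cexp_neg_mul_sq_norm_add (hre0 ε hε) _ _
  have hGn : ∀ ε, 0 ≤ ε → ∀ ξ, ‖G ε ξ‖ ≤ 1 := by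
    intro ε hε ξ
    rw [Complex.norm_exp, Real.exp_le_one_iff]
    have e : (-b ε * ‖ξ‖ ^ 2 + 2 * Real.pi * Complex.I * (inner ℝ (-y) ξ : ℝ) : ℂ).re =
        -((b ε).re * ‖ξ‖ ^ 2) := by
      have e1 : (-b ε * ‖ξ‖ ^ 2 + 2 * Real.pi * Complex.I * (inner ℝ (-y) ξ : ℝ) : ℂ) =
        -(b ε * ((‖ξ‖ ^ 2 : ℝ) : ℂ)) + ((2 * Real.pi * inner ℝ (-y) ξ : ℝ) : ℂ) * Complex.I := by
        push_cast; ring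
      rw [e1, Complex.add_re, Complex.neg_re, Complex.re_mul_ofReal, Complex.re_ofReal_mul,
        Complex.I_re]
      ring
    rw [e, hre]
    have := Real.pi_pos
    have : 0 ≤ 4 * Real.pi ^ 2 * ε * ‖ξ‖ ^ 2 := by positivity
    linarith
  have hGF : ∀ ε, 0 < ε → ∫ ξ, G ε ξ * 𝓕⁻ φ ξ =
      ∫ x, (Real.pi / b ε) ^ (n / 2 : ℂ) * Complex.exp (-Real.pi ^ 2 * ‖x - y‖ ^ 2 / b ε) * φ x := by
    intro ε hε
    have hφ : Integrable (fun x ↦ φ (-x)) := φ.integrable.comp_neg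
    have h1 : ∀ ξ, 𝓕⁻ φ ξ = 𝓕 (fun x ↦ φ (-x)) ξ := by
      intro ξ
      rw [SchwartzMap.fourierInv_coe, Real.fourierInv_eq_fourier_comp_neg]
    have h2 : ∫ ξ, 𝓕 (G ε) ξ * φ (-ξ) = ∫ ξ, G ε ξ * 𝓕 (fun x ↦ φ (-x)) ξ := by
      simpa using! VectorFourier.integral_fourierIntegral_smul_eq_flip (L := innerₗ 𝔼)
        Real.continuous_fourierChar continuous_inner (hG ε hε) hφ
    simp_rw [h1]
    rw [← h2, ← integral_neg_eq_self]
    refine integral_congr_ae (Filter.Eventually.of_forall fun x ↦ ?_)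
    simp only [G, neg_neg]
    rw [fourier_gaussian_innerProductSpace' (hre0 ε hε), finrank_euclideanSpace_fin]
    rw [show -y - -x = x - y by abel]
  have lim1 : Filter.Tendsto (fun ε ↦ ∫ ξ, G ε ξ * 𝓕⁻ φ ξ) (nhdsWithin 0 (Set.Ioi 0))
      (nhds (∫ ξ, G 0 ξ * 𝓕⁻ φ ξ)) := by
    refine tendsto_integral_filter_of_dominated_convergence (fun ξ ↦ ‖𝓕⁻ φ ξ‖) ?_ ?_ ?_ ?_
    · filter_upwards [self_mem_nhdsWithin] with ε hε
      exact (hG ε hε).1.mul (𝓕⁻ φ).integrable.1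
    · filter_upwards [self_mem_nhdsWithin] with ε hε
      refine Filter.Eventually.of_forall fun ξ ↦ ?_
      rw [norm_mul]
      exact mul_le_of_le_one_left (norm_nonneg _) (hGn ε (le_of_lt hε) ξ)
    · exact (𝓕⁻ φ).integrable.norm
    · refine Filter.Eventually.of_forall fun ξ ↦ ?_
      have : Continuous fun ε ↦ G ε ξ * 𝓕⁻ φ ξ := by fun_prop
      exact (this.tendsto 0).mono_left nhdsWithin_le_nhds
  have hdiv : ContinuousAt (fun ε ↦ (Real.pi : ℂ) / b ε) 0 :=
    continuousAt_const.div hb.continuousAt hb0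
  have hsl : (Real.pi : ℂ) / b 0 ∈ Complex.slitPlane := by
    right
    rw [hb0', ← div_div, Complex.div_I,
      show (Real.pi / (4 * Real.pi ^ 2 * t) : ℂ) = ((Real.pi / (4 * Real.pi ^ 2 * t) : ℝ) : ℂ) by
        push_cast; rfl]
    have h : Real.pi / (4 * Real.pi ^ 2 * t) ≠ 0 := by
      have := Real.pi_ne_zero
      positivity
    rw [← neg_mul, ← Complex.ofReal_neg, Complex.im_ofReal_mul, Complex.I_im]
    simpa using h
  have hpow : ContinuousAt (fun ε ↦ ((Real.pi : ℂ) / b ε) ^ (n / 2 : ℂ)) 0 :=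
    hdiv.cpow continuousAt_const hsl
  have lim2 : Filter.Tendsto (fun ε ↦ ∫ x, (Real.pi / b ε) ^ (n / 2 : ℂ) *
        Complex.exp (-Real.pi ^ 2 * ‖x - y‖ ^ 2 / b ε) * φ x) (nhdsWithin 0 (Set.Ioi 0))
      (nhds (∫ x, (Real.pi / b 0) ^ (n / 2 : ℂ) *
        Complex.exp (-Real.pi ^ 2 * ‖x - y‖ ^ 2 / b 0) * φ x)) := by
    refine tendsto_integral_filter_of_dominated_convergence
      (fun x ↦ (‖((Real.pi : ℂ) / b 0) ^ (n / 2 : ℂ)‖ + 1) * ‖φ x‖) ?_ ?_ ?_ ?_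
    · refine Filter.Eventually.of_forall fun ε ↦ ?_
      have : Continuous fun x ↦ (Real.pi / b ε) ^ (n / 2 : ℂ) *
        Complex.exp (-Real.pi ^ 2 * ‖x - y‖ ^ 2 / b ε) * φ x := by
        have := φ.continuous
        fun_prop
      exact this.aestronglyMeasurable
    · have h1 : ∀ᶠ ε in nhdsWithin (0 : ℝ) (Set.Ioi 0), ‖((Real.pi : ℂ) / b ε) ^ (n / 2 : ℂ)‖ <
          ‖((Real.pi : ℂ) / b 0) ^ (n / 2 : ℂ)‖ + 1 :=
        (hpow.norm.tendsto.mono_left nhdsWithin_le_nhds).eventually_lt_const (by linarith)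
      filter_upwards [h1, self_mem_nhdsWithin] with ε hε hε0
      refine Filter.Eventually.of_forall fun x ↦ ?_
      rw [norm_mul, norm_mul]
      refine mul_le_mul_of_nonneg_right ?_ (norm_nonneg _)
      have h2 : ‖Complex.exp (-Real.pi ^ 2 * ‖x - y‖ ^ 2 / b ε)‖ ≤ 1 := by
        rw [Complex.norm_exp, Real.exp_le_one_iff]
        have e : (-Real.pi ^ 2 * ‖x - y‖ ^ 2 / b ε : ℂ) =
            ((-(Real.pi ^ 2 * ‖x - y‖ ^ 2) : ℝ) : ℂ) * (b ε)⁻¹ := by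
          push_cast; ring
        rw [e, Complex.re_ofReal_mul, Complex.inv_re]
        refine mul_nonpos_of_nonpos_of_nonneg (by simp; positivity)
          (div_nonneg (hre0 ε hε0).le (Complex.normSq_nonneg _))
      calc _ ≤ ‖((Real.pi : ℂ) / b ε) ^ (n / 2 : ℂ)‖ * 1 := by gcongr
        _ ≤ _ := by rw [mul_one]; exact hε.le
    · exact φ.integrable.norm.const_mul _
    · refine Filter.Eventually.of_forall fun x ↦ ?_
      refine Filter.Tendsto.mono_left ?_ nhdsWithin_le_nhds
      refine (hpow.mul ?_).mul continuousAt_const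
      exact (continuousAt_const.div hb.continuousAt hb0).cexp
  have lim := tendsto_nhds_unique (lim1.congr' (by
    filter_upwards [self_mem_nhdsWithin] with ε hε using hGF ε hε)) lim2
  have hleft : 𝓕 (SchwartzMap.smulLeftCLM ℂ (schrodingerSymbol n t) (𝓕⁻ φ)) y =
      ∫ ξ, G 0 ξ * 𝓕⁻ φ ξ := by
    rw [SchwartzMap.fourier_coe, Real.fourier_eq']
    refine integral_congr_ae (Filter.Eventually.of_forall fun ξ ↦ ?_)
    simp only [G]
    rw [SchwartzMap.smulLeftCLM_apply_apply (schrodingerSymbol_hasTemperateGrowth n t),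
      schrodingerSymbol, smul_eq_mul, smul_eq_mul, ← mul_assoc, ← Complex.exp_add, hb0',
      inner_neg_left, real_inner_comm ξ]
    congr 2
    push_cast
    ring
  rw [hleft, lim]
  refine integral_congr_ae (Filter.Eventually.of_forall fun x ↦ ?_)
  simp only [schrodingerKernel, hb0']

/-- The dispersive estimate `‖e^{itΔ} f‖_∞ ≤ (4π|t|)^{-n/2} ‖f‖₁`. -/
theorem exists_schrodingerGroup_isGivenBy_of_integrable {t : ℝ} (ht : t ≠ 0) {u : 𝓢'(𝔼, ℂ)}
    {f : 𝔼 → ℂ} (hu : IsGivenBy u f) (hf : Integrable f volume) :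
    ∃ g : 𝔼 → ℂ, IsGivenBy (schrodingerGroup n t u) g ∧
      ∀ x, ‖g x‖ₑ ≤ ENNReal.ofReal (((4 * Real.pi * |t|)⁻¹) ^ (n / 2 : ℝ)) * ∫⁻ y, ‖f y‖ₑ := by
  have hK := continuous_schrodingerKernel (n := n) t
  let c := ((4 * Real.pi * |t|)⁻¹) ^ (n / 2 : ℝ)
  let g : 𝔼 → ℂ := fun x ↦ ∫ y, schrodingerKernel n t (x - y) * f y
  have hint : ∀ φ : 𝓢(𝔼, ℂ), Integrable
      (fun z : 𝔼 × 𝔼 ↦ φ z.1 * (schrodingerKernel n t (z.1 - z.2) * f z.2))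
      (volume.prod volume) := by
    intro φ
    have h1 := φ.integrable (μ := volume) |>.mul_prod hf
    have h2 := h1.bdd_mul (c := c) (f := fun z : 𝔼 × 𝔼 ↦ schrodingerKernel n t (z.1 - z.2))
      (by exact (hK.comp (by fun_prop)).aestronglyMeasurable)
      (Filter.Eventually.of_forall fun z ↦ (norm_schrodingerKernel t _).le)
    refine h2.congr (Filter.Eventually.of_forall fun z ↦ ?_)
    simp only
    ring
  have hbound : ∀ x, ‖g x‖ₑ ≤ ENNReal.ofReal c * ∫⁻ y, ‖f y‖ₑ := by
    intro x
    refine (enorm_integral_le_lintegral_enorm _).trans ?_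
    rw [← lintegral_const_mul' _ _ ENNReal.ofReal_ne_top]
    refine lintegral_mono fun y ↦ ?_
    rw [enorm_mul, ← ofReal_norm (schrodingerKernel n t _), norm_schrodingerKernel]
  have hgm : AEStronglyMeasurable g volume := by
    have : AEStronglyMeasurable (fun z : 𝔼 × 𝔼 ↦ schrodingerKernel n t (z.1 - z.2) * f z.2)
        (volume.prod volume) :=
      (hK.comp (by fun_prop)).aestronglyMeasurable.mul hf.1.comp_snd
    exact this.integral_prod_right'
  refine ⟨g, ⟨hgm, fun φ ↦ ?_⟩, hbound⟩
  have e : (fun x ↦ φ x * g x) =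
      fun x ↦ ∫ y, φ x * (schrodingerKernel n t (x - y) * f y) := by
    ext x
    simp only [g]
    rw [integral_const_mul]
  constructor
  · rw [e]
    exact (hint φ).integral_prod_left
  · rw [e, integral_integral_swap (hint φ), schrodingerGroup,
      TemperedDistribution.fourierMultiplierCLM_apply_apply, (hu.2 _).2]
    refine integral_congr_ae (Filter.Eventually.of_forall fun y ↦ ?_)
    simp only
    rw [fourier_schrodingerSymbol_smul_fourierInv ht, ← integral_mul_const]
    refine integral_congr_ae (Filter.Eventually.of_forall fun x ↦ ?_)
    simp only
    ring

end DispersiveEstimate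

/-! ### The decreasing rearrangement -/

section Rearrangement

variable {α : Type*} [MeasurableSpace α] {μ : Measure α}

theorem volume_Ioi_inter_ofReal_lt (c : ℝ≥0∞) :
    volume (Set.Ioi (0 : ℝ) ∩ {s | ENNReal.ofReal s < c}) = c := by
  rcases eq_or_ne c ∞ with rfl | hc
  · simp
  · have : Set.Ioi (0 : ℝ) ∩ {s | ENNReal.ofReal s < c} = Set.Ioo 0 c.toReal := by
      ext s
      simp only [Set.mem_inter_iff, Set.mem_Ioi, Set.mem_ofPred_eq, Set.mem_Ioo]
      exact and_congr_right fun hs ↦ ENNReal.ofReal_lt_iff_lt_toReal hs.le hc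
    rw [this, Real.volume_Ioo, sub_zero, ENNReal.ofReal_toReal hc]

/-- The layer cake formula for functions with values in `[0, ∞]`. -/
theorem lintegral_eq_lintegral_meas_ofReal_lt [SFinite μ] {φ : α → ℝ≥0∞} (hφ : AEMeasurable φ μ) :
    ∫⁻ x, φ x ∂μ = ∫⁻ a in Set.Ioi (0 : ℝ), μ {x | ENNReal.ofReal a < φ x} := by
  wlog hm : Measurable φ generalizing φ
  · rw [lintegral_congr_ae hφ.ae_eq_mk, this hφ.measurable_mk.aemeasurable hφ.measurable_mk]
    refine lintegral_congr fun a ↦ measure_congr ?_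
    filter_upwards [hφ.ae_eq_mk] with x hx
    exact congrArg (fun b ↦ ENNReal.ofReal a < b) hx.symm
  have hS : MeasurableSet {z : α × ℝ | ENNReal.ofReal z.2 < φ z.1} :=
    measurableSet_lt (by fun_prop) (by fun_prop)
  calc ∫⁻ x, φ x ∂μ
      = ∫⁻ x, ∫⁻ a : ℝ in Set.Ioi 0, {z : α × ℝ | ENNReal.ofReal z.2 < φ z.1}.indicator 1 (x, a)
          ∂volume ∂μ := by
        refine lintegral_congr fun x ↦ ?_
        have : (fun a ↦ {z : α × ℝ | ENNReal.ofReal z.2 < φ z.1}.indicator (1 : α × ℝ → ℝ≥0∞) (x, a))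
          = {a : ℝ | ENNReal.ofReal a < φ x}.indicator 1 := by
          ext a; simp [Set.indicator_apply]
        rw [this, lintegral_indicator_one (measurableSet_lt (by fun_prop) (by fun_prop)),
          Measure.restrict_apply (measurableSet_lt (by fun_prop) (by fun_prop)), Set.inter_comm,
          volume_Ioi_inter_ofReal_lt]
    _ = _ := by
        rw [lintegral_lintegral_swap (by exact (measurable_one.indicator hS).aemeasurable)]
        refine lintegral_congr fun a ↦ ?_
        have : (fun x ↦ {z : α × ℝ | ENNReal.ofReal z.2 < φ z.1}.indicator (1 : α × ℝ → ℝ≥0∞) (x, a))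
          = {x : α | ENNReal.ofReal a < φ x}.indicator 1 := by
          ext x; simp [Set.indicator_apply]
        rw [this, lintegral_indicator_one (measurableSet_lt (by fun_prop) (by fun_prop))]

/-- Equimeasurable functions have the same `L^q` integrals. -/
theorem lintegral_rpow_eq_of_meas_lt_eq {β : Type*} [MeasurableSpace β] {ν : Measure β}
    [SFinite μ] [SFinite ν] {φ : α → ℝ≥0∞} {ψ : β → ℝ≥0∞} (hφ : AEMeasurable φ μ)
    (hψ : AEMeasurable ψ ν) (h : ∀ a, μ {x | a < φ x} = ν {y | a < ψ y}) {q : ℝ} (hq : 0 < q) :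
    ∫⁻ x, φ x ^ q ∂μ = ∫⁻ y, ψ y ^ q ∂ν := by
  rw [lintegral_eq_lintegral_meas_ofReal_lt (hφ.pow_const q),
    lintegral_eq_lintegral_meas_ofReal_lt (hψ.pow_const q)]
  refine lintegral_congr fun a ↦ ?_
  simp_rw [← ENNReal.rpow_inv_lt_iff hq]
  exact h _

variable {f g : α → ℂ}

/-- The infimum defining `f*(s)` is attained, by continuity from below of the measure. -/
theorem decreasingRearrangement_le_iff {s : ℝ} {a : ℝ≥0∞} :
    decreasingRearrangement μ f s ≤ a ↔ μ {x | a < ‖f x‖ₑ} ≤ ENNReal.ofReal s := by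
  refine ⟨fun h ↦ ?_, fun h ↦ sInf_le h⟩
  rcases eq_or_ne a ∞ with rfl | ha
  · simp
  obtain ⟨b, b_anti, hb, b_lim⟩ := exists_seq_strictAnti_tendsto' (lt_top_iff_ne_top.2 ha)
  have hU : {x | a < ‖f x‖ₑ} = ⋃ k, {x | b k < ‖f x‖ₑ} := by
    ext x
    simp only [Set.mem_ofPred_eq, Set.mem_iUnion]
    refine ⟨fun hx ↦ ?_, fun ⟨k, hk⟩ ↦ (hb k).1.trans hk⟩
    exact (b_lim.eventually_lt_const hx).exists
  have hmono : Monotone fun k ↦ {x | b k < ‖f x‖ₑ} :=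
    fun i j hij x hx ↦ lt_of_le_of_lt (b_anti.antitone hij) hx
  rw [hU, hmono.measure_iUnion]
  refine iSup_le fun k ↦ ?_
  obtain ⟨c, hc, hck⟩ := sInf_lt_iff.1 (lt_of_le_of_lt h (hb k).1)
  exact (measure_mono fun x hx ↦ lt_trans hck hx).trans hc

theorem lt_decreasingRearrangement_iff {s : ℝ} {a : ℝ≥0∞} :
    a < decreasingRearrangement μ f s ↔ ENNReal.ofReal s < μ {x | a < ‖f x‖ₑ} := by
  rw [← not_le, decreasingRearrangement_le_iff, not_le]

theorem decreasingRearrangement_antitone : Antitone (decreasingRearrangement μ f) := by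
  intro s t hst
  rw [decreasingRearrangement_le_iff]
  exact (decreasingRearrangement_le_iff.1 le_rfl).trans (ENNReal.ofReal_le_ofReal hst)

theorem measurable_decreasingRearrangement : Measurable (decreasingRearrangement μ f) :=
  decreasingRearrangement_antitone.measurable

theorem decreasingRearrangement_mono_ae (h : ∀ᵐ x ∂μ, ‖f x‖ₑ ≤ ‖g x‖ₑ) (s : ℝ) :
    decreasingRearrangement μ f s ≤ decreasingRearrangement μ g s := by
  rw [decreasingRearrangement_le_iff]
  refine le_trans (measure_mono_ae ?_) (decreasingRearrangement_le_iff (f := g).1 le_rfl)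
  filter_upwards [h] with x hx hx' using lt_of_lt_of_le hx' hx

theorem decreasingRearrangement_congr_ae (h : f =ᵐ[μ] g) :
    decreasingRearrangement μ f = decreasingRearrangement μ g := by
  ext s
  refine le_antisymm (decreasingRearrangement_mono_ae ?_ s) (decreasingRearrangement_mono_ae ?_ s)
  all_goals filter_upwards [h] with x hx; simp [hx]

theorem eLorentzNorm_congr_ae (h : f =ᵐ[μ] g) (p q : ℝ) :
    eLorentzNorm f p q μ = eLorentzNorm g p q μ := by
  rw [eLorentzNorm, eLorentzNorm, decreasingRearrangement_congr_ae h]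

theorem decreasingRearrangement_le_of_bound {c : ℝ≥0∞} (h : ∀ᵐ x ∂μ, ‖f x‖ₑ ≤ c) (s : ℝ) :
    decreasingRearrangement μ f s ≤ c := by
  rw [decreasingRearrangement_le_iff]
  have : μ {x | c < ‖f x‖ₑ} = 0 := by
    simpa [ae_iff] using h
  rw [this]
  exact zero_le

/-- A function and its decreasing rearrangement are equimeasurable. -/
theorem lintegral_enorm_rpow_eq_lintegral_decreasingRearrangement [SFinite μ]
    (hf : AEStronglyMeasurable f μ) {q : ℝ} (hq : 0 < q) :
    ∫⁻ x, ‖f x‖ₑ ^ q ∂μ = ∫⁻ s in Set.Ioi (0 : ℝ), decreasingRearrangement μ f s ^ q := by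
  refine lintegral_rpow_eq_of_meas_lt_eq hf.enorm
    measurable_decreasingRearrangement.aemeasurable (fun a ↦ ?_) hq
  rw [Measure.restrict_apply (measurableSet_lt measurable_const measurable_decreasingRearrangement),
    Set.inter_comm]
  simp_rw [lt_decreasingRearrangement_iff]
  rw [volume_Ioi_inter_ofReal_lt]

/-- The part of `f` above the height `f*(γ)` has a rearrangement that is at most `f*` and vanishes
on `[γ, ∞)`, as that part is supported on a set of measure at most `γ`. -/
theorem lintegral_enorm_indicator_lt_le [SFinite μ] (hf : AEStronglyMeasurable f μ) (γ : ℝ) :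
    ∫⁻ x, ‖{x | decreasingRearrangement μ f γ < ‖f x‖ₑ}.indicator f x‖ₑ ∂μ ≤
      ∫⁻ s in Set.Ioo 0 γ, decreasingRearrangement μ f s := by
  set h := decreasingRearrangement μ f γ with hh
  set f₀ := {x | h < ‖f x‖ₑ}.indicator f with hf₀
  have hm : AEStronglyMeasurable f₀ μ :=
    hf.indicator₀ (nullMeasurableSet_lt aemeasurable_const hf.enorm)
  have e := lintegral_enorm_rpow_eq_lintegral_decreasingRearrangement hm one_pos
  simp only [ENNReal.rpow_one] at e
  rw [e, ← lintegral_indicator measurableSet_Ioi, ← lintegral_indicator measurableSet_Ioo]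
  refine lintegral_mono fun s ↦ ?_
  by_cases hs : s ∈ Set.Ioi (0 : ℝ)
  · rw [Set.indicator_of_mem hs]
    by_cases hsγ : s < γ
    · rw [Set.indicator_of_mem (Set.mem_Ioo.2 ⟨hs, hsγ⟩)]
      exact decreasingRearrangement_mono_ae
        (Filter.Eventually.of_forall fun x ↦ enorm_indicator_le_enorm_self _ _) s
    · refine le_trans (le_of_eq ?_) zero_le
      rw [← nonpos_iff_eq_zero, decreasingRearrangement_le_iff]
      have h1 : μ {x | h < ‖f x‖ₑ} ≤ ENNReal.ofReal γ := decreasingRearrangement_le_iff.1 hh.ge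
      refine le_trans (measure_mono fun x hx ↦ ?_)
        (h1.trans (ENNReal.ofReal_le_ofReal (not_lt.1 hsγ)))
      by_contra hx'
      have hx0 : h < ‖f x‖ₑ ∧ ¬f x = 0 := by simpa [hf₀] using hx
      exact hx' hx0.1
  · rw [Set.indicator_of_notMem hs]
    exact zero_le

/-- The part of `f` below the height `f*(γ)` has a rearrangement that is at most `f*(γ)` on `(0, γ)`
and at most `f*` on `[γ, ∞)`; since `f*` decreases, `γ f*(γ)` is at most its integral over
`(0, γ)`. -/
theorem lintegral_enorm_sq_indicator_le_le [SFinite μ] (hf : AEStronglyMeasurable f μ) {γ : ℝ}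
    (hγ : 0 < γ) :
    ∫⁻ x, ‖{x | decreasingRearrangement μ f γ < ‖f x‖ₑ}ᶜ.indicator f x‖ₑ ^ (2 : ℝ) ∂μ ≤
      (∫⁻ s in Set.Ioo 0 γ, decreasingRearrangement μ f s) ^ (2 : ℝ) / ENNReal.ofReal γ +
      ∫⁻ s in Set.Ici γ, decreasingRearrangement μ f s ^ (2 : ℝ) := by
  set h := decreasingRearrangement μ f γ with hh
  set f₁ := {x | h < ‖f x‖ₑ}ᶜ.indicator f with hf₁
  have hm : AEStronglyMeasurable f₁ μ :=
    hf.indicator₀ (nullMeasurableSet_lt aemeasurable_const hf.enorm).compl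
  have hγ' : ENNReal.ofReal γ ≠ 0 := by simpa
  rw [lintegral_enorm_rpow_eq_lintegral_decreasingRearrangement hm two_pos,
    ← Set.Ioo_union_Ici_eq_Ioi hγ]
  refine (lintegral_union_le _ _ _).trans (add_le_add ?_ ?_)
  · have h1 : ∀ s, decreasingRearrangement μ f₁ s ≤ h := fun s ↦ by
      refine decreasingRearrangement_le_of_bound (Filter.Eventually.of_forall fun x ↦ ?_) s
      by_cases hx : h < ‖f x‖ₑ
      · rw [hf₁, Set.indicator_of_notMem (by simpa using hx)]
        simp
      · rw [hf₁, Set.indicator_of_mem (by simpa using hx)]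
        exact not_lt.1 hx
    have h2 : ENNReal.ofReal γ * h ≤ ∫⁻ s in Set.Ioo 0 γ, decreasingRearrangement μ f s := by
      calc ENNReal.ofReal γ * h = ∫⁻ s in Set.Ioo 0 γ, h := by
            rw [setLIntegral_const, Real.volume_Ioo, sub_zero, mul_comm]
        _ ≤ _ := setLIntegral_mono measurable_decreasingRearrangement
            fun s hs ↦ decreasingRearrangement_antitone hs.2.le
    calc ∫⁻ s in Set.Ioo 0 γ, decreasingRearrangement μ f₁ s ^ (2 : ℝ)
        ≤ ∫⁻ s in Set.Ioo 0 γ, h ^ (2 : ℝ) := lintegral_mono fun s ↦ by gcongr; exact h1 s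
      _ = (ENNReal.ofReal γ * h) ^ (2 : ℝ) / ENNReal.ofReal γ := by
        rw [setLIntegral_const, Real.volume_Ioo, sub_zero, ENNReal.mul_rpow_of_nonneg _ _ two_pos.le,
          ENNReal.rpow_two (ENNReal.ofReal γ), sq, mul_assoc, mul_div_assoc,
          ← ENNReal.mul_comm_div, ENNReal.div_self hγ' ENNReal.ofReal_ne_top, one_mul, mul_comm]
      _ ≤ _ := by gcongr
  · refine lintegral_mono fun s ↦ ?_
    gcongr
    exact decreasingRearrangement_mono_ae
      (Filter.Eventually.of_forall fun x ↦ enorm_indicator_le_enorm_self _ _) s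

end Rearrangement

/-! ### Hardy inequalities on the half-line -/

section Hardy

theorem lintegral_Ioo_ofReal_rpow {a c : ℝ} (ha : -1 < a) (hc : 0 < c) :
    ∫⁻ s in Set.Ioo 0 c, ENNReal.ofReal s ^ a =
      ENNReal.ofReal c ^ (a + 1) / ENNReal.ofReal (a + 1) := by
  have ha' : 0 < a + 1 := by linarith
  have h1 : IntegrableOn (fun s : ℝ ↦ s ^ a) (Set.Ioo 0 c) :=
    (intervalIntegral.integrableOn_Ioo_rpow_iff hc).2 ha
  calc ∫⁻ s in Set.Ioo 0 c, ENNReal.ofReal s ^ a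
      = ∫⁻ s in Set.Ioo 0 c, ENNReal.ofReal (s ^ a) :=
        setLIntegral_congr_fun measurableSet_Ioo fun s hs ↦ ENNReal.ofReal_rpow_of_pos hs.1
    _ = ENNReal.ofReal (∫ s in Set.Ioo 0 c, s ^ a) := by
        rw [ofReal_integral_eq_lintegral_ofReal h1]
        filter_upwards [ae_restrict_mem measurableSet_Ioo] with s hs
        exact Real.rpow_nonneg hs.1.le a
    _ = _ := by
        rw [← integral_Ioc_eq_integral_Ioo, ← intervalIntegral.integral_of_le hc.le,
          integral_rpow (Or.inl ha), Real.zero_rpow ha'.ne', sub_zero,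
          ENNReal.ofReal_div_of_pos ha', ENNReal.ofReal_rpow_of_pos hc]

theorem lintegral_Ici_ofReal_rpow {a c : ℝ} (ha : a < -1) (hc : 0 < c) :
    ∫⁻ s in Set.Ici c, ENNReal.ofReal s ^ a =
      ENNReal.ofReal c ^ (a + 1) / ENNReal.ofReal (-(a + 1)) := by
  have ha' : 0 < -(a + 1) := by linarith
  rw [← restrict_Ioi_eq_restrict_Ici]
  calc ∫⁻ s in Set.Ioi c, ENNReal.ofReal s ^ a
      = ∫⁻ s in Set.Ioi c, ENNReal.ofReal (s ^ a) :=
        setLIntegral_congr_fun measurableSet_Ioi fun s hs ↦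
          ENNReal.ofReal_rpow_of_pos (hc.trans hs)
    _ = ENNReal.ofReal (∫ s in Set.Ioi c, s ^ a) := by
        rw [ofReal_integral_eq_lintegral_ofReal (integrableOn_Ioi_rpow_of_lt ha hc)]
        filter_upwards [ae_restrict_mem measurableSet_Ioi] with s hs
        exact Real.rpow_nonneg (hc.trans hs).le a
    _ = _ := by
        rw [integral_Ioi_rpow_of_lt ha hc, neg_div, ← div_neg, ENNReal.ofReal_div_of_pos ha',
          ENNReal.ofReal_rpow_of_pos hc]

/-- Tonelli's theorem over the part of the quadrant `(0, ∞)²` that lies in `R`, with sections `A`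
and `B`. -/
theorem lintegral_Ioi_mul_lintegral_section_swap {R : Set (ℝ × ℝ)} (hR : MeasurableSet R)
    {A B : ℝ → Set ℝ} (hA : ∀ s, 0 < s → A s = Set.Ioi 0 ∩ {u | (s, u) ∈ R})
    (hB : ∀ u, 0 < u → B u = Set.Ioi 0 ∩ {s | (s, u) ∈ R}) {W Φ : ℝ → ℝ≥0∞}
    (hW : Measurable W) (hΦ : Measurable Φ) :
    ∫⁻ s in Set.Ioi 0, W s * ∫⁻ u in A s, Φ u = ∫⁻ u in Set.Ioi 0, Φ u * ∫⁻ s in B u, W s := by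
  have hm : Measurable (R.indicator fun z : ℝ × ℝ ↦ W z.1 * Φ z.2) :=
    Measurable.indicator (by fun_prop) hR
  calc ∫⁻ s in Set.Ioi 0, W s * ∫⁻ u in A s, Φ u
      = ∫⁻ s in Set.Ioi 0, ∫⁻ u in Set.Ioi 0, R.indicator (fun z ↦ W z.1 * Φ z.2) (s, u) := by
        refine setLIntegral_congr_fun measurableSet_Ioi fun s hs ↦ ?_
        have hRs : MeasurableSet {u | (s, u) ∈ R} := measurable_prodMk_left hR
        rw [hA s hs, ← lintegral_const_mul _ hΦ, Set.inter_comm, ← Measure.restrict_restrict hRs,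
          ← lintegral_indicator hRs]
        rfl
    _ = ∫⁻ u in Set.Ioi 0, ∫⁻ s in Set.Ioi 0, R.indicator (fun z ↦ W z.1 * Φ z.2) (s, u) :=
        lintegral_lintegral_swap hm.aemeasurable
    _ = _ := by
        refine setLIntegral_congr_fun measurableSet_Ioi fun u hu ↦ ?_
        have hRu : MeasurableSet {s | (s, u) ∈ R} := measurable_prodMk_right hR
        rw [hB u hu, ← lintegral_const_mul _ hW, Set.inter_comm, ← Measure.restrict_restrict hRu,
          ← lintegral_indicator hRu]
        refine lintegral_congr fun s ↦ ?_
        by_cases h : (s, u) ∈ R <;> simp [Set.indicator, h, mul_comm]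

theorem ofReal_rpow_div_eq {K u a : ℝ} (hK : 0 < K) (hu : 0 < u) :
    ENNReal.ofReal (K / u) ^ a = ENNReal.ofReal K ^ a * ENNReal.ofReal u ^ (-a) := by
  rw [ENNReal.ofReal_rpow_of_pos (by positivity), ENNReal.ofReal_rpow_of_pos hK,
    ENNReal.ofReal_rpow_of_pos hu, ← ENNReal.ofReal_mul (by positivity), Real.div_rpow hK.le hu.le,
    Real.rpow_neg hu.le, div_eq_mul_inv]

theorem ofReal_rpow_add {u : ℝ} (hu : 0 < u) (a b : ℝ) :
    ENNReal.ofReal u ^ (a + b) = ENNReal.ofReal u ^ a * ENNReal.ofReal u ^ b :=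
  ENNReal.rpow_add _ _ (by simpa) ENNReal.ofReal_ne_top

variable {φ : ℝ → ℝ≥0∞}

/-- Cauchy–Schwarz with the weights `u^{±(1-a)/2}`. -/
theorem sq_lintegral_Ioo_le (hφ : Measurable φ) {a γ : ℝ} (ha : 0 < a) (hγ : 0 < γ) :
    (∫⁻ u in Set.Ioo 0 γ, φ u) ^ (2 : ℝ) ≤ ENNReal.ofReal γ ^ a / ENNReal.ofReal a *
      ∫⁻ u in Set.Ioo 0 γ, ENNReal.ofReal u ^ (1 - a) * φ u ^ (2 : ℝ) := by
  have hconj : (2 : ℝ).HolderConjugate 2 := Real.HolderConjugate.two_two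
  have h := ENNReal.lintegral_mul_le_Lp_mul_Lq (volume.restrict (Set.Ioo 0 γ)) hconj
    (f := fun u ↦ ENNReal.ofReal u ^ ((a - 1) / 2))
    (g := fun u ↦ ENNReal.ofReal u ^ ((1 - a) / 2) * φ u) (by fun_prop) (by fun_prop)
  have e1 : ∫⁻ u in Set.Ioo 0 γ, φ u = ∫⁻ u in Set.Ioo 0 γ, ((fun u ↦ ENNReal.ofReal u ^ ((a - 1) / 2))
      * fun u ↦ ENNReal.ofReal u ^ ((1 - a) / 2) * φ u) u := by
    refine setLIntegral_congr_fun measurableSet_Ioo fun u hu ↦ ?_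
    simp only [Pi.mul_apply]
    rw [← mul_assoc, ← ofReal_rpow_add hu.1, ← add_div]
    simp
  rw [e1]
  refine (ENNReal.rpow_le_rpow h two_pos.le).trans (le_of_eq ?_)
  rw [ENNReal.mul_rpow_of_nonneg _ _ two_pos.le, ← ENNReal.rpow_mul, ← ENNReal.rpow_mul]
  norm_num only [ENNReal.rpow_one]
  congr 1
  · have := lintegral_Ioo_ofReal_rpow (a := a - 1) (by linarith) hγ
    rw [sub_add_cancel] at this
    rw [← this]
    refine lintegral_congr fun u ↦ ?_
    rw [← ENNReal.rpow_mul]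
    norm_num
  · refine lintegral_congr fun u ↦ ?_
    rw [ENNReal.mul_rpow_of_nonneg _ _ two_pos.le, ← ENNReal.rpow_mul]
    norm_num

/-- Hardy's inequality for `∫₀^γ φ` in the variable `s = K / γ`. -/
theorem lintegral_rpow_mul_sq_lintegral_Ioo_div_le (hφ : Measurable φ) {a K : ℝ} (ha : 0 < a)
    (hK : 0 < K) :
    ∫⁻ s in Set.Ioi 0, ENNReal.ofReal s ^ (2 * a - 1) * (∫⁻ u in Set.Ioo 0 (K / s), φ u) ^ (2 : ℝ) ≤
      ENNReal.ofReal K ^ (2 * a) / ENNReal.ofReal a ^ (2 : ℝ) *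
        ∫⁻ u in Set.Ioi 0, ENNReal.ofReal u ^ (1 - 2 * a) * φ u ^ (2 : ℝ) := by
  have hR : MeasurableSet {z : ℝ × ℝ | z.1 * z.2 < K} :=
    measurableSet_lt (by fun_prop) (by fun_prop)
  set c := ENNReal.ofReal K ^ a / ENNReal.ofReal a with hc
  calc ∫⁻ s in Set.Ioi 0,
        ENNReal.ofReal s ^ (2 * a - 1) * (∫⁻ u in Set.Ioo 0 (K / s), φ u) ^ (2 : ℝ)
      ≤ ∫⁻ s in Set.Ioi 0, c * (ENNReal.ofReal s ^ (a - 1) *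
          ∫⁻ u in Set.Ioo 0 (K / s), ENNReal.ofReal u ^ (1 - a) * φ u ^ (2 : ℝ)) := by
        refine setLIntegral_mono' measurableSet_Ioi fun s hs ↦ ?_
        have hs : 0 < s := hs
        refine (mul_le_mul_right (sq_lintegral_Ioo_le hφ ha (div_pos hK hs)) _).trans
          (le_of_eq ?_)
        rw [ofReal_rpow_div_eq hK hs, show 2 * a - 1 = (a - 1) + a by ring, ofReal_rpow_add hs,
          hc, ← mul_assoc, ← mul_assoc]
        congr 1
        have : ENNReal.ofReal s ^ a * ENNReal.ofReal s ^ (-a) = 1 := by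
          rw [← ofReal_rpow_add hs]; simp
        calc _ = (ENNReal.ofReal s ^ a * ENNReal.ofReal s ^ (-a)) *
              (ENNReal.ofReal K ^ a / ENNReal.ofReal a * ENNReal.ofReal s ^ (a - 1)) := by
              simp only [div_eq_mul_inv]; ring
          _ = _ := by rw [this, one_mul]
    _ = c * ∫⁻ s in Set.Ioi 0, ENNReal.ofReal s ^ (a - 1) *
          ∫⁻ u in Set.Ioo 0 (K / s), ENNReal.ofReal u ^ (1 - a) * φ u ^ (2 : ℝ) := by
        refine lintegral_const_mul' _ _ (ENNReal.div_ne_top ?_ (by simpa))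
        exact ENNReal.rpow_ne_top_of_nonneg ha.le ENNReal.ofReal_ne_top
    _ = c * ∫⁻ u in Set.Ioi 0, ENNReal.ofReal u ^ (1 - a) * φ u ^ (2 : ℝ) *
          ∫⁻ s in Set.Ioo 0 (K / u), ENNReal.ofReal s ^ (a - 1) := by
        rw [lintegral_Ioi_mul_lintegral_section_swap hR (B := fun u ↦ Set.Ioo 0 (K / u)) ?_ ?_
          (by fun_prop) (by fun_prop)]
        · intro s hs
          ext u
          simp [lt_div_iff₀ hs, mul_comm]
        · intro u hu
          ext s
          simp [lt_div_iff₀ hu]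
    _ = c * ∫⁻ u in Set.Ioi 0, c * (ENNReal.ofReal u ^ (1 - 2 * a) * φ u ^ (2 : ℝ)) := by
        congr 1
        refine setLIntegral_congr_fun measurableSet_Ioi fun u hu ↦ ?_
        have hu : 0 < u := hu
        rw [lintegral_Ioo_ofReal_rpow (by linarith) (div_pos hK hu), sub_add_cancel,
          ofReal_rpow_div_eq hK hu, show 1 - 2 * a = (1 - a) + -a by ring, ofReal_rpow_add hu, hc]
        simp only [div_eq_mul_inv]
        ring
    _ = _ := by
        rw [lintegral_const_mul _ (by fun_prop), ← mul_assoc]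
        congr 1
        rw [hc, two_mul, ofReal_rpow_add hK, ENNReal.rpow_two, sq, div_eq_mul_inv, div_eq_mul_inv,
          ENNReal.mul_inv (by simp) (by simp)]
        ring

theorem lintegral_rpow_mul_lintegral_Ici_div (hφ : Measurable φ) {a K : ℝ} (ha : 2 * a < 1)
    (hK : 0 < K) :
    ∫⁻ s in Set.Ioi 0, ENNReal.ofReal s ^ (2 * a - 2) * ∫⁻ u in Set.Ici (K / s), φ u ^ (2 : ℝ) =
      ENNReal.ofReal K ^ (2 * a - 1) / ENNReal.ofReal (1 - 2 * a) *
        ∫⁻ u in Set.Ioi 0, ENNReal.ofReal u ^ (1 - 2 * a) * φ u ^ (2 : ℝ) := by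
  have hR : MeasurableSet {z : ℝ × ℝ | K ≤ z.1 * z.2} :=
    measurableSet_le (by fun_prop) (by fun_prop)
  have hpos : ∀ {s u : ℝ}, 0 < s → K ≤ s * u → 0 < u := fun hs h ↦
    pos_of_mul_pos_right (hK.trans_le h) hs.le
  rw [lintegral_Ioi_mul_lintegral_section_swap hR (B := fun u ↦ Set.Ici (K / u)) ?_ ?_
    (by fun_prop) (by fun_prop), ← lintegral_const_mul _ (by fun_prop)]
  · refine setLIntegral_congr_fun measurableSet_Ioi fun u hu ↦ ?_
    have hu : 0 < u := hu
    rw [lintegral_Ici_ofReal_rpow (by linarith) (div_pos hK hu),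
      show 2 * a - 2 + 1 = 2 * a - 1 by ring, ofReal_rpow_div_eq hK hu, neg_sub]
    simp only [div_eq_mul_inv]
    ring
  · intro s hs
    ext u
    simp only [Set.mem_Ici, div_le_iff₀ hs, Set.mem_inter_iff, Set.mem_Ioi, Set.mem_ofPred_eq,
      mul_comm u s]
    exact ⟨fun h ↦ ⟨hpos hs h, h⟩, fun h ↦ h.2⟩
  · intro u hu
    ext s
    simp only [Set.mem_Ici, div_le_iff₀ hu, Set.mem_inter_iff, Set.mem_Ioi, Set.mem_ofPred_eq]
    exact ⟨fun h ↦ ⟨hpos hu (mul_comm s u ▸ h), h⟩, fun h ↦ h.2⟩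

theorem measurable_lintegral_Ioo_div (φ : ℝ → ℝ≥0∞) (K : ℝ) :
    Measurable fun s ↦ ∫⁻ u in Set.Ioo 0 (K / s), φ u := by
  have h : Monotone fun γ : ℝ ↦ ∫⁻ u in Set.Ioo 0 γ, φ u :=
    fun a b hab ↦ lintegral_mono_set (Set.Ioo_subset_Ioo_right hab)
  exact h.measurable.comp (measurable_const.div measurable_id)

theorem measurable_lintegral_Ici_div (φ : ℝ → ℝ≥0∞) (K : ℝ) :
    Measurable fun s ↦ ∫⁻ u in Set.Ici (K / s), φ u := by
  have h : Antitone fun γ : ℝ ↦ ∫⁻ u in Set.Ici γ, φ u :=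
    fun a b hab ↦ lintegral_mono_set (Set.Ici_subset_Ici.2 hab)
  exact h.measurable.comp (measurable_const.div measurable_id)

end Hardy

/-! ### Real interpolation for Lorentz spaces -/

section Interpolation

variable {α : Type*} [MeasurableSpace α] {μ : Measure α} {f g : α → ℂ}

theorem eLorentzNorm_two_eq (f : α → ℂ) (r : ℝ) (μ : Measure α) :
    eLorentzNorm f r 2 μ = (∫⁻ s in Set.Ioi (0 : ℝ),
      ENNReal.ofReal s ^ (2 / r - 1) * decreasingRearrangement μ f s ^ (2 : ℝ)) ^ (1 / 2 : ℝ) := by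
  rw [eLorentzNorm]
  congr 1
  refine setLIntegral_congr_fun measurableSet_Ioi fun s hs ↦ ?_
  have hs' : ENNReal.ofReal s ≠ 0 := by simpa using hs
  rw [ENNReal.mul_rpow_of_nonneg _ _ two_pos.le, ← ENNReal.rpow_mul,
    ENNReal.rpow_sub _ _ hs' ENNReal.ofReal_ne_top, ENNReal.rpow_one,
    show 1 / r * 2 = 2 / r by ring]
  simp only [div_eq_mul_inv]
  ring

/-- The Lorentz space `L^{2,2}` is `L²`, with the same norm. -/
theorem eLorentzNorm_two_two [SFinite μ] (hf : AEStronglyMeasurable f μ) :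
    eLorentzNorm f 2 2 μ = eLpNorm f 2 μ := by
  rw [eLorentzNorm_two_eq, eLpNorm_eq_lintegral_rpow_enorm_toReal two_ne_zero ENNReal.ofNat_ne_top,
    ENNReal.toReal_ofNat, lintegral_enorm_rpow_eq_lintegral_decreasingRearrangement hf two_pos]
  norm_num

theorem eLorentzNorm_two_conjExponent_eq {p : ℝ} (hp : 1 < p) (f : α → ℂ) (μ : Measure α) :
    eLorentzNorm f (Real.conjExponent p) 2 μ = (∫⁻ s in Set.Ioi (0 : ℝ),
      ENNReal.ofReal s ^ (1 - 2 * p⁻¹) * decreasingRearrangement μ f s ^ (2 : ℝ)) ^ (1 / 2 : ℝ) := by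
  have h0 : p ≠ 0 := by positivity
  have h1 : p - 1 ≠ 0 := by linarith
  rw [eLorentzNorm_two_eq, show 2 / Real.conjExponent p - 1 = 1 - 2 * p⁻¹ by
    rw [Real.conjExponent]; field_simp; ring]

theorem ae_eq_zero_of_eLorentzNorm_eq_zero [SFinite μ] (hf : AEStronglyMeasurable f μ) {r : ℝ}
    (h : eLorentzNorm f r 2 μ = 0) : f =ᵐ[μ] 0 := by
  rw [eLorentzNorm_two_eq, ENNReal.rpow_eq_zero_iff_of_pos (by norm_num),
    lintegral_eq_zero_iff (by
      have := measurable_decreasingRearrangement (μ := μ) (f := f)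
      fun_prop)] at h
  have h1 : ∫⁻ x, ‖f x‖ₑ ^ (1 : ℝ) ∂μ = 0 := by
    rw [lintegral_enorm_rpow_eq_lintegral_decreasingRearrangement hf one_pos,
      lintegral_eq_zero_iff (by
        have := measurable_decreasingRearrangement (μ := μ) (f := f)
        fun_prop)]
    filter_upwards [h, ae_restrict_mem measurableSet_Ioi] with s hs hs0
    have hs0 : 0 < s := hs0
    have : ENNReal.ofReal s ^ (2 / r - 1) ≠ 0 := by
      rw [ENNReal.ofReal_rpow_of_pos hs0]
      have := Real.rpow_pos_of_pos hs0 (2 / r - 1)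
      simpa
    simpa [this] using hs
  simp only [ENNReal.rpow_one] at h1
  rw [lintegral_eq_zero_iff' hf.enorm] at h1
  filter_upwards [h1] with x hx
  simpa using hx

/-- Chebyshev's inequality for the rearrangement. -/
theorem ofReal_mul_decreasingRearrangement_sq_le [SFinite μ] (hf : AEStronglyMeasurable f μ)
    (s : ℝ) :
    ENNReal.ofReal s * decreasingRearrangement μ f s ^ (2 : ℝ) ≤ ∫⁻ x, ‖f x‖ₑ ^ (2 : ℝ) ∂μ := by
  rw [lintegral_enorm_rpow_eq_lintegral_decreasingRearrangement hf two_pos]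
  calc ENNReal.ofReal s * decreasingRearrangement μ f s ^ (2 : ℝ)
      = ∫⁻ _ in Set.Ioo 0 s, decreasingRearrangement μ f s ^ (2 : ℝ) := by
        rw [setLIntegral_const, Real.volume_Ioo, sub_zero, mul_comm]
    _ ≤ ∫⁻ u in Set.Ioo 0 s, decreasingRearrangement μ f u ^ (2 : ℝ) := by
        refine setLIntegral_mono (measurable_decreasingRearrangement.pow_const _) fun u hu ↦ ?_
        gcongr
        exact decreasingRearrangement_antitone hu.2.le
    _ ≤ _ := lintegral_mono_set Set.Ioo_subset_Ioi_self

theorem decreasingRearrangement_add_le {c : ℝ≥0∞} (h : ∀ᵐ x ∂μ, ‖f x‖ₑ ≤ c) (s : ℝ) :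
    decreasingRearrangement μ (f + g) s ≤ c + decreasingRearrangement μ g s := by
  rw [decreasingRearrangement_le_iff]
  refine le_trans (measure_mono_ae ?_) (decreasingRearrangement_le_iff (f := g).1 le_rfl)
  filter_upwards [h] with x hx hx'
  have h1 : c + decreasingRearrangement μ g s < ‖f x + g x‖ₑ := hx'
  have h2 := h1.trans_le ((enorm_add_le _ _).trans (add_le_add_left hx _))
  exact lt_of_add_lt_add_left h2

theorem add_sq_le_two_mul (a b : ℝ≥0∞) :
    (a + b) ^ (2 : ℝ) ≤ 2 * a ^ (2 : ℝ) + 2 * b ^ (2 : ℝ) := by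
  have h := ENNReal.rpow_add_le_mul_rpow_add_rpow a b (p := 2) one_le_two
  norm_num [mul_add] at h ⊢
  exact h

theorem eLpNorm_two_rpow_two (f : α → ℂ) (μ : Measure α) :
    eLpNorm f 2 μ ^ (2 : ℝ) = ∫⁻ x, ‖f x‖ₑ ^ (2 : ℝ) ∂μ := by
  rw [eLpNorm_eq_lintegral_rpow_enorm_toReal two_ne_zero ENNReal.ofNat_ne_top,
    ENNReal.toReal_ofNat, ← ENNReal.rpow_mul]
  norm_num

/-- The part of `f` above the height `f*(γ)` is in `L¹` and the part below is in `L²`, with norms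
controlled by integrals of `f*`. -/
theorem exists_truncation [SFinite μ] (hf : AEStronglyMeasurable f μ) {γ : ℝ} (hγ : 0 < γ)
    (hF : ∫⁻ s in Set.Ioo 0 γ, decreasingRearrangement μ f s ≠ ∞)
    (hG : ∫⁻ s in Set.Ici γ, decreasingRearrangement μ f s ^ (2 : ℝ) ≠ ∞) :
    ∃ f₀ f₁ : α → ℂ, f₀ + f₁ = f ∧ MemLp f₀ 1 μ ∧ MemLp f₁ 2 μ ∧
      ∫⁻ x, ‖f₀ x‖ₑ ∂μ ≤ ∫⁻ s in Set.Ioo 0 γ, decreasingRearrangement μ f s ∧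
      eLpNorm f₁ 2 μ ^ (2 : ℝ) ≤
        (∫⁻ s in Set.Ioo 0 γ, decreasingRearrangement μ f s) ^ (2 : ℝ) / ENNReal.ofReal γ +
        ∫⁻ s in Set.Ici γ, decreasingRearrangement μ f s ^ (2 : ℝ) := by
  have hS : NullMeasurableSet {x | decreasingRearrangement μ f γ < ‖f x‖ₑ} μ :=
    nullMeasurableSet_lt aemeasurable_const hf.enorm
  have h0 := lintegral_enorm_indicator_lt_le hf γ
  have h1 := lintegral_enorm_sq_indicator_le_le hf hγ
  rw [← eLpNorm_two_rpow_two] at h1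
  refine ⟨_, _, Set.indicator_self_add_compl {x | decreasingRearrangement μ f γ < ‖f x‖ₑ} f,
    ⟨hf.indicator₀ hS, ?_⟩, ⟨hf.indicator₀ hS.compl, ?_⟩, h0, h1⟩
  · rw [eLpNorm_one_eq_lintegral_enorm]
    exact h0.trans_lt hF.lt_top
  · refine (ENNReal.rpow_lt_top_iff_of_pos two_pos).1 (h1.trans_lt ?_)
    refine ENNReal.add_lt_top.2 ⟨ENNReal.div_lt_top ?_ (by simpa), hG.lt_top⟩
    exact ENNReal.rpow_ne_top_of_nonneg two_pos.le hF

theorem MemLorentz.lintegral_lt_top {p : ℝ} (hp : 2 < p)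
    (hf : MemLorentz f (Real.conjExponent p) 2 μ) :
    ∫⁻ s in Set.Ioi (0 : ℝ),
      ENNReal.ofReal s ^ (1 - 2 * p⁻¹) * decreasingRearrangement μ f s ^ (2 : ℝ) < ∞ := by
  have h := hf.2
  rwa [eLorentzNorm_two_conjExponent_eq (by linarith),
    ENNReal.rpow_lt_top_iff_of_pos (by norm_num)] at h

/-- Truncating `f ∈ L^{p',2}` at a suitable height puts it in `L¹ + L²`. -/
theorem MemLorentz.exists_add_eq [SFinite μ] {p : ℝ} (hp : 2 < p)
    (hf : MemLorentz f (Real.conjExponent p) 2 μ) :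
    ∃ f₀ f₁ : α → ℂ, f₀ + f₁ = f ∧ MemLp f₀ 1 μ ∧ MemLp f₁ 2 μ := by
  have hp0 : 0 < p⁻¹ := by positivity
  have hp1 : 2 * p⁻¹ < 1 := by
    rw [← div_eq_mul_inv, div_lt_one (by linarith)]
    exact hp
  have hN := hf.lintegral_lt_top hp
  have hφ := measurable_decreasingRearrangement (μ := μ) (f := f)
  have mF := measurable_lintegral_Ioo_div (decreasingRearrangement μ f) 1
  have mG := measurable_lintegral_Ici_div (fun u ↦ decreasingRearrangement μ f u ^ (2 : ℝ)) 1
  -- Both Hardy integrals converge, so their integrands are finite at almost every `s`.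
  have hF := (lintegral_rpow_mul_sq_lintegral_Ioo_div_le hφ hp0 one_pos).trans_lt
    (ENNReal.mul_lt_top (ENNReal.div_lt_top (by simp) (by
      rw [ENNReal.ofReal_rpow_of_pos hp0]; simp; positivity)) hN)
  have hG := (lintegral_rpow_mul_lintegral_Ici_div hφ hp1 one_pos).trans_lt
    (ENNReal.mul_lt_top (ENNReal.div_lt_top (by simp) (by simpa using hp1)) hN)
  have : (ae (volume.restrict (Set.Ioi (0 : ℝ)))).NeBot := by
    rw [ae_neBot, Ne, Measure.restrict_eq_zero]
    simp
  obtain ⟨s, hs, hs1, hs2⟩ := ((ae_restrict_mem measurableSet_Ioi).and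
    ((ae_lt_top (by fun_prop) hF.ne).and (ae_lt_top (by fun_prop) hG.ne))).exists
  have hs : 0 < s := hs
  have hw : ∀ a : ℝ, ENNReal.ofReal s ^ a ≠ 0 := fun a ↦ by
    rw [ENNReal.ofReal_rpow_of_pos hs]
    simpa using Real.rpow_pos_of_pos hs a
  obtain ⟨f₀, f₁, h, h0, h1, -⟩ := exists_truncation hf.1 (γ := 1 / s) (by positivity)
    (fun h ↦ by
      simp only [h] at hs1
      rw [ENNReal.top_rpow_of_pos two_pos, ENNReal.mul_top (hw _)] at hs1
      exact lt_irrefl _ hs1)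
    (fun h ↦ by
      simp only [h] at hs2
      rw [ENNReal.mul_top (hw _)] at hs2
      exact lt_irrefl _ hs2)
  exact ⟨f₀, f₁, h, h0, h1⟩

/-- If every splitting `f = f₀ + f₁` into `L¹ + L²` is accompanied by a splitting `g = g₀ + g₁` with
`‖g₀‖_∞ ≤ A ‖f₀‖₁` and `‖g₁‖₂ ≤ ‖f₁‖₂`, the rearrangement of `g` at `s` is controlled by that of `f`
on both sides of the point `K / s`, where `K = A⁻²`. -/
theorem decreasingRearrangement_sq_le_of_splitting [SFinite μ] (hf : AEStronglyMeasurable f μ)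
    {A : ℝ≥0∞} {K : ℝ} (hK : 0 < K) (hA : A ^ (2 : ℝ) = (ENNReal.ofReal K)⁻¹)
    (H : ∀ f₀ f₁ : α → ℂ, f₀ + f₁ = f → MemLp f₀ 1 μ → MemLp f₁ 2 μ →
      ∃ g₀ g₁ : α → ℂ, g =ᵐ[μ] g₀ + g₁ ∧ (∀ᵐ x ∂μ, ‖g₀ x‖ₑ ≤ A * ∫⁻ x, ‖f₀ x‖ₑ ∂μ) ∧
        AEStronglyMeasurable g₁ μ ∧ eLpNorm g₁ 2 μ ≤ eLpNorm f₁ 2 μ) {s : ℝ} (hs : 0 < s) :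
    decreasingRearrangement μ g s ^ (2 : ℝ) ≤
      4 * (ENNReal.ofReal K)⁻¹ *
          (∫⁻ u in Set.Ioo 0 (K / s), decreasingRearrangement μ f u) ^ (2 : ℝ) +
        2 * (ENNReal.ofReal s)⁻¹ *
          ∫⁻ u in Set.Ici (K / s), decreasingRearrangement μ f u ^ (2 : ℝ) := by
  set F := ∫⁻ u in Set.Ioo 0 (K / s), decreasingRearrangement μ f u with hFdef
  set G := ∫⁻ u in Set.Ici (K / s), decreasingRearrangement μ f u ^ (2 : ℝ) with hGdef
  have hs0 : ENNReal.ofReal s ≠ 0 := by simpa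
  have hK0 : ENNReal.ofReal K ≠ 0 := by simpa
  rcases eq_or_ne F ∞ with hF | hF
  · rw [hF, ENNReal.top_rpow_of_pos two_pos, ENNReal.mul_top (by simp), top_add]
    exact le_top
  rcases eq_or_ne G ∞ with hG | hG
  · rw [hG, ENNReal.mul_top (by simp), add_top]
    exact le_top
  obtain ⟨f₀, f₁, h, h0, h1, hb0, hb1⟩ := exists_truncation hf (div_pos hK hs) hF hG
  obtain ⟨g₀, g₁, hg, hg0, hg1m, hg1⟩ := H f₀ f₁ h h0 h1
  have e1 : decreasingRearrangement μ g s ≤ A * F + decreasingRearrangement μ g₁ s := by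
    rw [decreasingRearrangement_congr_ae hg]
    refine decreasingRearrangement_add_le ?_ s
    filter_upwards [hg0] with x hx
    exact hx.trans (by gcongr)
  have e2 : decreasingRearrangement μ g₁ s ^ (2 : ℝ) ≤
      (ENNReal.ofReal s)⁻¹ * (F ^ (2 : ℝ) / ENNReal.ofReal (K / s) + G) := by
    rw [← ENNReal.div_eq_inv_mul, ENNReal.le_div_iff_mul_le (Or.inl hs0)
      (Or.inl ENNReal.ofReal_ne_top), mul_comm]
    refine (ofReal_mul_decreasingRearrangement_sq_le hg1m s).trans ?_
    rw [← eLpNorm_two_rpow_two]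
    exact (ENNReal.rpow_le_rpow hg1 two_pos.le).trans hb1
  have e3 : (ENNReal.ofReal s)⁻¹ * (F ^ (2 : ℝ) / ENNReal.ofReal (K / s)) =
      (ENNReal.ofReal K)⁻¹ * F ^ (2 : ℝ) := by
    rw [ENNReal.ofReal_div_of_pos hs, div_eq_mul_inv, ENNReal.inv_div
      (Or.inl ENNReal.ofReal_ne_top) (Or.inl hs0), div_eq_mul_inv]
    calc _ = ((ENNReal.ofReal s)⁻¹ * ENNReal.ofReal s) * ((ENNReal.ofReal K)⁻¹ * F ^ (2 : ℝ)) := by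
          ring
      _ = _ := by rw [ENNReal.inv_mul_cancel hs0 ENNReal.ofReal_ne_top, one_mul]
  calc decreasingRearrangement μ g s ^ (2 : ℝ)
      ≤ (A * F + decreasingRearrangement μ g₁ s) ^ (2 : ℝ) := ENNReal.rpow_le_rpow e1 two_pos.le
    _ ≤ 2 * (A * F) ^ (2 : ℝ) + 2 * decreasingRearrangement μ g₁ s ^ (2 : ℝ) := add_sq_le_two_mul _ _
    _ ≤ 2 * (A * F) ^ (2 : ℝ) +
        2 * ((ENNReal.ofReal s)⁻¹ * (F ^ (2 : ℝ) / ENNReal.ofReal (K / s) + G)) := by gcongr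
    _ = _ := by
        rw [ENNReal.mul_rpow_of_nonneg _ _ two_pos.le, hA, mul_add (ENNReal.ofReal s)⁻¹, e3]
        ring

/-- Real interpolation between `L¹ → L^∞` with norm `A = K^{-1/2}` and `L² → L²` with norm `1`, for
Lorentz spaces with second exponent `2`. -/
theorem eLorentzNorm_le_of_splitting [SFinite μ] {p : ℝ} (hp : 2 < p)
    (hf : AEStronglyMeasurable f μ) {A : ℝ≥0∞} {K : ℝ} (hK : 0 < K)
    (hA : A ^ (2 : ℝ) = (ENNReal.ofReal K)⁻¹)
    (H : ∀ f₀ f₁ : α → ℂ, f₀ + f₁ = f → MemLp f₀ 1 μ → MemLp f₁ 2 μ →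
      ∃ g₀ g₁ : α → ℂ, g =ᵐ[μ] g₀ + g₁ ∧ (∀ᵐ x ∂μ, ‖g₀ x‖ₑ ≤ A * ∫⁻ x, ‖f₀ x‖ₑ ∂μ) ∧
        AEStronglyMeasurable g₁ μ ∧ eLpNorm g₁ 2 μ ≤ eLpNorm f₁ 2 μ) :
    eLorentzNorm g p 2 μ ≤
      (4 / ENNReal.ofReal p⁻¹ ^ (2 : ℝ) + 2 / ENNReal.ofReal (1 - 2 * p⁻¹)) ^ (1 / 2 : ℝ) *
        ENNReal.ofReal K ^ (p⁻¹ - 1 / 2) * eLorentzNorm f (Real.conjExponent p) 2 μ := by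
  have hp0 : 0 < p⁻¹ := by positivity
  have hp1 : 2 * p⁻¹ < 1 := by
    rw [← div_eq_mul_inv, div_lt_one (by linarith)]
    exact hp
  rw [eLorentzNorm_two_conjExponent_eq (by linarith), eLorentzNorm_two_eq, div_eq_mul_inv 2 p,
    show p⁻¹ - 1 / 2 = (2 * p⁻¹ - 1) * (1 / 2 : ℝ) by ring, ENNReal.rpow_mul,
    ← ENNReal.mul_rpow_of_nonneg _ _ (by norm_num), ← ENNReal.mul_rpow_of_nonneg _ _ (by norm_num)]
  refine ENNReal.rpow_le_rpow ?_ (by norm_num)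
  set a := p⁻¹
  have hφ := measurable_decreasingRearrangement (μ := μ) (f := f)
  have mF := measurable_lintegral_Ioo_div (decreasingRearrangement μ f) K
  have mG := measurable_lintegral_Ici_div (fun u ↦ decreasingRearrangement μ f u ^ (2 : ℝ)) K
  set N := ∫⁻ u in Set.Ioi 0, ENNReal.ofReal u ^ (1 - 2 * a) *
    decreasingRearrangement μ f u ^ (2 : ℝ)
  have hKpow : (ENNReal.ofReal K)⁻¹ * ENNReal.ofReal K ^ (2 * a) =
      ENNReal.ofReal K ^ (2 * a - 1) := by
    rw [← ENNReal.rpow_neg_one, ← ofReal_rpow_add hK]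
    ring_nf
  calc ∫⁻ s in Set.Ioi (0 : ℝ),
        ENNReal.ofReal s ^ (2 * a - 1) * decreasingRearrangement μ g s ^ (2 : ℝ)
      ≤ ∫⁻ s in Set.Ioi (0 : ℝ), (4 * (ENNReal.ofReal K)⁻¹ * (ENNReal.ofReal s ^ (2 * a - 1) *
            (∫⁻ u in Set.Ioo 0 (K / s), decreasingRearrangement μ f u) ^ (2 : ℝ)) +
          2 * (ENNReal.ofReal s ^ (2 * a - 2) *
            ∫⁻ u in Set.Ici (K / s), decreasingRearrangement μ f u ^ (2 : ℝ))) := by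
        refine setLIntegral_mono' measurableSet_Ioi fun s hs ↦ ?_
        refine (mul_le_mul_right
          (decreasingRearrangement_sq_le_of_splitting hf hK hA H hs) _).trans (le_of_eq ?_)
        rw [show 2 * a - 2 = (2 * a - 1) + -1 by ring, ofReal_rpow_add hs, ENNReal.rpow_neg_one]
        ring
    _ = 4 * (ENNReal.ofReal K)⁻¹ * (∫⁻ s in Set.Ioi (0 : ℝ), ENNReal.ofReal s ^ (2 * a - 1) *
            (∫⁻ u in Set.Ioo 0 (K / s), decreasingRearrangement μ f u) ^ (2 : ℝ)) +
          2 * ∫⁻ s in Set.Ioi (0 : ℝ), ENNReal.ofReal s ^ (2 * a - 2) *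
            ∫⁻ u in Set.Ici (K / s), decreasingRearrangement μ f u ^ (2 : ℝ) := by
        rw [lintegral_add_left (by fun_prop), lintegral_const_mul _ (by fun_prop),
          lintegral_const_mul _ (by fun_prop)]
    _ ≤ 4 * (ENNReal.ofReal K)⁻¹ *
            (ENNReal.ofReal K ^ (2 * a) / ENNReal.ofReal a ^ (2 : ℝ) * N) +
          2 * (ENNReal.ofReal K ^ (2 * a - 1) / ENNReal.ofReal (1 - 2 * a) * N) :=
        add_le_add (mul_le_mul_right (lintegral_rpow_mul_sq_lintegral_Ioo_div_le hφ hp0 hK) _)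
          (mul_le_mul_right (lintegral_rpow_mul_lintegral_Ici_div hφ hp1 hK).le _)
    _ = _ := by
        rw [← hKpow]
        simp only [div_eq_mul_inv]
        ring

end Interpolation

/-! ### The Lorentz space estimate -/

section LorentzEstimate

variable {n : ℕ}

local notation "𝔼" => EuclideanSpace ℝ (Fin n)

theorem MemLorentz.exists_isGivenBy {p : ℝ} (hp : 2 < p) {f : 𝔼 → ℂ}
    (hf : MemLorentz f (Real.conjExponent p) 2 volume) : ∃ u : 𝓢'(𝔼, ℂ), IsGivenBy u f := by
  obtain ⟨f₀, f₁, rfl, h0, h1⟩ := hf.exists_add_eq hp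
  obtain ⟨u₀, hu₀⟩ := exists_isGivenBy_of_memLp le_rfl h0
  obtain ⟨u₁, hu₁⟩ := exists_isGivenBy_of_memLp one_le_two h1
  exact ⟨_, hu₀.add hu₁⟩

/-- Every splitting of `f` into `L¹ + L²` is carried by `e^{itΔ}` into one of the output into
`L^∞ + L²`. -/
theorem exists_schrodingerGroup_isGivenBy_add {t : ℝ} (ht : t ≠ 0) {u : 𝓢'(𝔼, ℂ)} {f₀ f₁ : 𝔼 → ℂ}
    (hu : IsGivenBy u (f₀ + f₁)) (h0 : MemLp f₀ 1 volume) (h1 : MemLp f₁ 2 volume) :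
    ∃ g₀ g₁ : 𝔼 → ℂ, IsGivenBy (schrodingerGroup n t u) (g₀ + g₁) ∧
      (∀ᵐ x, ‖g₀ x‖ₑ ≤ ENNReal.ofReal (((4 * Real.pi * |t|)⁻¹) ^ (n / 2 : ℝ)) * ∫⁻ y, ‖f₀ y‖ₑ) ∧
      AEStronglyMeasurable g₁ volume ∧ eLpNorm g₁ 2 volume ≤ eLpNorm f₁ 2 volume := by
  obtain ⟨u₀, hu₀⟩ := exists_isGivenBy_of_memLp le_rfl h0
  obtain ⟨u₁, hu₁⟩ := exists_isGivenBy_of_memLp one_le_two h1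
  obtain ⟨g₀, hg₀, hb₀⟩ :=
    exists_schrodingerGroup_isGivenBy_of_integrable ht hu₀ (memLp_one_iff_integrable.1 h0)
  obtain ⟨g₁, hg₁, hb₁⟩ := exists_schrodingerGroup_isGivenBy_of_memLp_two t hu₁ h1
  refine ⟨g₀, g₁, ?_, Filter.Eventually.of_forall hb₀, hg₁.1, hb₁⟩
  rw [hu.eq (hu₀.add hu₁), map_add]
  exact hg₀.add hg₁

theorem exists_schrodingerGroup_isGivenBy_eLorentzNorm_le {p : ℝ} (hp : 2 < p) {t : ℝ} (ht : t ≠ 0)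
    {u : 𝓢'(𝔼, ℂ)} {f : 𝔼 → ℂ} (hf : MemLorentz f (Real.conjExponent p) 2 volume)
    (hu : IsGivenBy u f) :
    ∃ g : 𝔼 → ℂ, IsGivenBy (schrodingerGroup n t u) g ∧
      eLorentzNorm g p 2 volume ≤
        (4 / ENNReal.ofReal p⁻¹ ^ (2 : ℝ) + 2 / ENNReal.ofReal (1 - 2 * p⁻¹)) ^ (1 / 2 : ℝ) *
          ENNReal.ofReal ((4 * Real.pi * |t|) ^ n) ^ (p⁻¹ - 1 / 2) *
          eLorentzNorm f (Real.conjExponent p) 2 volume := by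
  have ht' : 0 < |t| := abs_pos.2 ht
  have hpi := Real.pi_pos
  obtain ⟨f₀, f₁, h, h0, h1⟩ := hf.exists_add_eq hp
  obtain ⟨g₀, g₁, hg, -⟩ := exists_schrodingerGroup_isGivenBy_add ht (h ▸ hu) h0 h1
  refine ⟨_, hg, eLorentzNorm_le_of_splitting hp hf.1
    (A := ENNReal.ofReal (((4 * Real.pi * |t|)⁻¹) ^ (n / 2 : ℝ))) (by positivity) ?_ ?_⟩
  · rw [ENNReal.ofReal_rpow_of_pos (by positivity), ← ENNReal.ofReal_inv_of_pos (by positivity),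
      ← Real.rpow_mul (by positivity), div_mul_cancel₀ _ two_ne_zero, Real.rpow_natCast, inv_pow]
  · intro f₀' f₁' h' h0' h1'
    obtain ⟨g₀', g₁', hg', hb⟩ := exists_schrodingerGroup_isGivenBy_add ht (h' ▸ hu) h0' h1'
    exact ⟨g₀', g₁', hg.ae_eq hg', hb⟩

theorem schrodingerGroup_zero (u : 𝓢'(𝔼, ℂ)) : schrodingerGroup n 0 u = u := by
  have : schrodingerSymbol n 0 = fun _ ↦ 1 := by
    ext ξ
    simp [schrodingerSymbol]
  rw [schrodingerGroup, this]
  simp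

/-- On the one-point space `ℝ⁰` the frequency variable vanishes. -/
theorem schrodingerGroup_dim_zero (s t : ℝ) : schrodingerGroup 0 s = schrodingerGroup 0 t := by
  have : schrodingerSymbol 0 s = schrodingerSymbol 0 t := by
    ext ξ
    simp [schrodingerSymbol, Subsingleton.elim ξ 0]
  rw [schrodingerGroup, this, schrodingerGroup]

end LorentzEstimate

theorem lemma3p1 (n : ℕ) (p : ℝ) (hp : 2 ≤ p) :
    ∃ C : ℝ≥0, ∀ (t : ℝ) (f : EuclideanSpace ℝ (Fin n) → ℂ),
      MemLorentz f (Real.conjExponent p) 2 volume →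
        ∃ (u : 𝓢'(EuclideanSpace ℝ (Fin n), ℂ)) (g : EuclideanSpace ℝ (Fin n) → ℂ),
          IsGivenBy u f ∧ IsGivenBy (schrodingerGroup n t u) g ∧
            eLorentzNorm g p 2 volume ≤
              C * ENNReal.ofReal |t| ^ (-((n : ℝ) * (1 / 2 - 1 / p))) *
                eLorentzNorm f (Real.conjExponent p) 2 volume := by
  rcases hp.eq_or_lt with rfl | hp
  · refine ⟨1, fun t f hf ↦ ?_⟩
    have e : Real.conjExponent 2 = 2 := by norm_num [Real.conjExponent]
    rw [e] at hf ⊢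
    have hf2 : MemLp f 2 volume := ⟨hf.1, eLorentzNorm_two_two hf.1 ▸ hf.2⟩
    obtain ⟨u, hu⟩ := exists_isGivenBy_of_memLp one_le_two hf2
    obtain ⟨g, hg, hb⟩ := exists_schrodingerGroup_isGivenBy_of_memLp_two t hu hf2
    refine ⟨u, g, hu, hg, ?_⟩
    rw [eLorentzNorm_two_two hf.1, eLorentzNorm_two_two hg.1]
    simpa using hb
  have hpi := Real.pi_pos
  have hp0 : 0 < p⁻¹ := by positivity
  have hp1 : 2 * p⁻¹ < 1 := by
    rw [← div_eq_mul_inv, div_lt_one (by linarith)]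
    exact hp
  set c : ℝ≥0∞ :=
    (4 / ENNReal.ofReal p⁻¹ ^ (2 : ℝ) + 2 / ENNReal.ofReal (1 - 2 * p⁻¹)) ^ (1 / 2 : ℝ) with hc
  have hc_top : c ≠ ∞ := by
    refine ENNReal.rpow_ne_top_of_nonneg (by norm_num) (ENNReal.add_ne_top.2 ⟨?_, ?_⟩)
    · refine ENNReal.div_ne_top (by simp) ?_
      rw [ENNReal.ofReal_rpow_of_pos hp0]
      simp
      positivity
    · exact ENNReal.div_ne_top (by simp) (by simpa using hp1)
  set e := (n : ℝ) * (1 / 2 - 1 / p) with he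
  set d : ℝ≥0∞ := ENNReal.ofReal (4 * Real.pi) ^ (-e) with hd
  have hd_top : d ≠ ∞ := by
    rw [hd, ENNReal.ofReal_rpow_of_pos (by positivity)]
    exact ENNReal.ofReal_ne_top
  -- Adding `1` keeps the constant positive, as `t = 0` requires.
  refine ⟨(c * d).toNNReal + 1, fun t f hf ↦ ?_⟩
  have hC : c * d ≤ (((c * d).toNNReal + 1 : ℝ≥0) : ℝ≥0∞) := by
    rw [ENNReal.coe_add, ENNReal.coe_toNNReal (ENNReal.mul_ne_top hc_top hd_top)]
    exact le_self_add
  obtain ⟨u, hu⟩ := hf.exists_isGivenBy hp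
  have main : ∀ s : ℝ, s ≠ 0 → ∃ g, IsGivenBy (schrodingerGroup n s u) g ∧
      eLorentzNorm g p 2 volume ≤ (((c * d).toNNReal + 1 : ℝ≥0) : ℝ≥0∞) *
        ENNReal.ofReal |s| ^ (-e) * eLorentzNorm f (Real.conjExponent p) 2 volume := by
    intro s hs
    obtain ⟨g, hg, hb⟩ := exists_schrodingerGroup_isGivenBy_eLorentzNorm_le hp hs hf hu
    refine ⟨g, hg, hb.trans ?_⟩
    have hs' : 0 < |s| := abs_pos.2 hs
    have hpow : ENNReal.ofReal ((4 * Real.pi * |s|) ^ n) ^ (p⁻¹ - 1 / 2) =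
        d * ENNReal.ofReal |s| ^ (-e) := by
      rw [hd, ENNReal.ofReal_pow (by positivity), ← ENNReal.rpow_natCast, ← ENNReal.rpow_mul,
        ENNReal.ofReal_mul (by positivity), ENNReal.mul_rpow_of_ne_top ENNReal.ofReal_ne_top
        ENNReal.ofReal_ne_top, he]
      ring_nf
    rw [hpow, ← mul_assoc]
    gcongr
  rcases ne_or_eq t 0 with ht | rfl
  · obtain ⟨g, hg, hb⟩ := main t ht
    exact ⟨u, g, hu, hg, hb⟩
  rcases Nat.eq_zero_or_pos n with rfl | hn
  · obtain ⟨g, hg, hb⟩ := main 1 one_ne_zero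
    rw [schrodingerGroup_dim_zero 1 0] at hg
    refine ⟨u, g, hu, hg, ?_⟩
    simpa [he] using hb
  -- For `t = 0 < n` and `p > 2` the right-hand side is infinite unless `f = 0`.
  refine ⟨u, f, hu, by rwa [schrodingerGroup_zero], ?_⟩
  have hepos : 0 < e := by
    have : 0 < 1 / 2 - 1 / p := by rw [one_div p]; linarith
    positivity
  rcases eq_or_ne (eLorentzNorm f (Real.conjExponent p) 2 volume) 0 with h0 | h0
  · have hf0 := ae_eq_zero_of_eLorentzNorm_eq_zero hf.1 h0
    have h1 : eLorentzNorm f p 2 volume = eLorentzNorm f (Real.conjExponent p) 2 volume := by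
      rw [eLorentzNorm_congr_ae hf0, eLorentzNorm_congr_ae hf0]
      have hz : ∀ s, decreasingRearrangement volume (0 : EuclideanSpace ℝ (Fin n) → ℂ) s = 0 :=
        fun s ↦ nonpos_iff_eq_zero.1 (decreasingRearrangement_le_of_bound (by simp) s)
      simp [eLorentzNorm_two_eq, hz]
    rw [h1, h0]
    exact zero_le
  · rw [abs_zero, ENNReal.ofReal_zero, ENNReal.zero_rpow_of_neg (neg_neg_of_pos hepos),
      ENNReal.mul_top (by simp), ENNReal.top_mul h0]
    exact le_top
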